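/- A finite set of points in the plane is generic if no three of its points are collinear. For a generic set $\mathcal P$ and distinct $P,Q\in\mathcal P$, let $n(P,Q)$ be the number of lines defined by pairs of points of $\mathcal P\setminus\{P,Q\}$ which separate $P$ from $Q$, i.e. for which $P$ and $Q$ lie in different components of the complement of the line. A rectilinear drawing $R(G)$ of a finite graph $G=(V,E)$ places the vertices bijectively at the points of a generic set and draws the edges as straight segments; its crossing number is $n(R(G))=\sum_{(s,t)\in E} n(s,t)$, where $n(s,t)$ is taken with respect to all points of the drawing. The Orchard crossing number is $\mathrm{OCN}(G)=\min_{R(G)} n(R(G))$. Let $K_{n,1}$ be the star with $n$ leaves, and let the wheel $W_{n,1}$ be the cycle of length $n$ together with one further vertex, the hub, joined to every vertex of the cycle. **Proposition.** Let $n\ge 5$. (1) There are rectilinear drawings of $W_{n,1}$ in which the vertices of the cycle are, in their cyclic order, the vertices of a regular $n$-gon and the hub is located at the center of the polygon if $n$ is odd, and close to the center if $n$ is even, meaning that no line defined by two points of the drawing separates the hub from the center. Every such drawing has the minimal crossing number $\mathrm{OCN}(W_{n,1})$. (2) Hence $$\mathrm{OCN}(W_{n,1})=\begin{cases}\dfrac{n(n^2-4n+11)}{8}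 & \text{if } n \text{ is odd},\\[2mm] \dfrac{n(n^2-4n+12)}{8} & \text{if } n \text{ is even}.\end{cases}$$ (3) Every rectilinear drawing $R(W_{n,1})$ satisfies $n(R(W_{n,1}))\ge \mathrm{OCN}(K_{n,1})+n$. -/

import Mathlib

open scoped Affine

/-- The Euclidean plane. -/
abbrev Plane : Type := EuclideanSpace ℝ (Fin 2)

/-- A set of points in the plane is generic if no three of its points are collinear. -/
def IsGeneric (S : Set Plane) : Prop :=
  ∀ A ∈ S, ∀ B ∈ S, ∀ C ∈ S, A ≠ B → A ≠ C → B ≠ C → ¬ Collinear ℝ {A, B, C}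

/-- The lines defined by pairs of distinct points of `S`. -/
def definedLines (S : Set Plane) : Set (AffineSubspace ℝ Plane) :=
  {L | ∃ A ∈ S, ∃ B ∈ S, A ≠ B ∧ L = line[ℝ, A, B]}

/-- The number `n(P, Q)` of lines defined by pairs of points of `S \ {P, Q}` which separate
`P` and `Q`, i.e. such that `P` and `Q` lie strictly on opposite sides of the line. -/
noncomputable def separationNumber (S : Set Plane) (P Q : Plane) : ℕ :=
  {L ∈ definedLines (S \ {P, Q}) | L.SOppSide P Q}.ncard

theorem separationNumber_comm (S : Set Plane) (P Q : Plane) :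
    separationNumber S P Q = separationNumber S Q P := by
  simp only [separationNumber, Set.pair_comm P Q, AffineSubspace.sOppSide_comm (x := P)]

/-- A rectilinear drawing of a graph with vertex type `V`: the vertices are placed at distinct
points of the plane, no three of them collinear.  The edges of the graph are drawn as straight
segments, hence are determined by the positions of the vertices. -/
structure RectilinearDrawing (V : Type*) where
  /-- The position of each vertex. -/
  pos : V → Plane
  injective_pos : Function.Injective pos
  generic_range : IsGeneric (Set.range pos)

open Classical in
/-- The crossing number `n(R(G))` of a rectilinear drawing of `G`: the sum of `n(s, t)` over the
edges `(s, t)` of `G`, where the lines defined by all pairs of points of the drawing are used. -/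
noncomputable def RectilinearDrawing.crossingNumber {V : Type*} [Fintype V]
    (R : RectilinearDrawing V) (G : SimpleGraph V) : ℕ :=
  ∑ e ∈ G.edgeFinset,
    Sym2.lift ⟨fun s t => separationNumber (Set.range R.pos) (R.pos s) (R.pos t),
      fun _ _ => separationNumber_comm _ _ _⟩ e

/-- The Orchard crossing number of `G`: the minimum of the crossing numbers of its rectilinear
drawings. -/
noncomputable def orchardCrossingNumber {V : Type*} [Fintype V] (G : SimpleGraph V) : ℕ :=
  sInf (Set.range fun R : RectilinearDrawing V => R.crossingNumber G)

/-- The star `K_{n,1}`; its center, the hub, is `Sum.inr 0`. -/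
abbrev starGraph (n : ℕ) : SimpleGraph (Fin n ⊕ Fin 1) :=
  completeBipartiteGraph (Fin n) (Fin 1)

/-- The wheel `W_{n,1}` (for `n ≥ 3`): a cycle of length `n` on the vertices `Sum.inl i`, together
with a hub `Sum.inr 0` joined to all vertices of the cycle. -/
def wheelGraph (n : ℕ) : SimpleGraph (Fin n ⊕ Fin 1) :=
  (SimpleGraph.cycleGraph n).map Function.Embedding.inl ⊔ starGraph n

/-- `p 0, …, p (n - 1)` are, in counterclockwise order, the vertices of a regular `n`-gon with
center `c` (for `n ≥ 3`). -/
def IsRegularPolygon {n : ℕ} (c : Plane) (p : Fin n → Plane) : Prop :=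
  ∃ r θ : ℝ, 0 < r ∧ ∀ i : Fin n,
    p i = c + r • !₂[Real.cos (θ + 2 * Real.pi * (i : ℝ) / n),
      Real.sin (θ + 2 * Real.pi * (i : ℝ) / n)]

/-- In the drawing `R`, the points `R.pos (Sum.inl i)` form, in their cyclic order, a regular
`n`-gon, and the hub `R.pos (Sum.inr 0)` is located at its center if `n` is odd, and is not
separated from its center by a line defined by two points of the configuration if `n` is even. -/
def IsCenteredRegularDrawing {n : ℕ} (R : RectilinearDrawing (Fin n ⊕ Fin 1)) : Prop :=
  ∃ c : Plane, IsRegularPolygon c (fun i => R.pos (Sum.inl i)) ∧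
    (Odd n → R.pos (Sum.inr 0) = c) ∧
    (Even n → ∀ L ∈ definedLines (Set.range R.pos), ¬ L.SOppSide (R.pos (Sum.inr 0)) c)

/-! The crossing number of the wheel splits into `spokeCrossings` and `rimCrossings`. Everything is
read off from signs of orientations, chiefly the antisymmetric matrix `hubOrient i j`, whose signs
form a tournament on the leaves.

Lower bound for the spokes: if a triple of leaves has a source in this tournament, the hub lies
outside its triangle, and some side separates the hub from the opposite leaf. The number of such
triples is governed by the sum of d(d - 1) over the outdegrees d. Their total is n(n - 1)/2, so
convexity over the integers gives `starBound n ≤ 8 * spokeCrossings`.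

Lower bound for the rim: if every line through the hub and a leaf has leaves on both sides, the rim
must cross each of these n lines, so the rim costs at least n. Otherwise all leaves lie on one side
of such a line. Then no triangle of leaves contains the hub, every triple costs at least one, and
the binomial coefficient C(n, 3) alone exceeds or meets the bound once n ≥ 5. Together this is
`starBound_add_le`.

Upper bound: the regular drawings are `IsBalanced`. This combinatorial property alone makes the
outdegree estimate exact for the spokes and bounds the rim by n. Existence of a regular drawing then
gives the minimum, the formulas and the comparison with the star. -/

/-! ### Orientations, lines and sides in the plane -/

/-- Twice the signed area of the triangle `A B C`. -/
def orient (A B C : Plane) : ℝ :=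
  (B 0 - A 0) * (C 1 - A 1) - (B 1 - A 1) * (C 0 - A 0)

theorem orient_rotate (A B C : Plane) : orient A B C = orient B C A := by
  unfold orient; ring

theorem orient_swap (A B C : Plane) : orient A C B = -orient A B C := by
  unfold orient; ring

theorem orient_swap_left (A B C : Plane) : orient B A C = -orient A B C := by
  unfold orient; ring

@[simp] theorem orient_self_left (A B : Plane) : orient A A B = 0 := by
  unfold orient; ring

@[simp] theorem orient_self_right (A B : Plane) : orient A B B = 0 := by
  unfold orient; ring

@[simp] theorem orient_self_outer (A B : Plane) : orient A B A = 0 := by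
  unfold orient; ring

theorem orient_eq_add (H A B C : Plane) :
    orient A B C = orient H A B + orient H B C + orient H C A := by
  unfold orient; ring

theorem orient_lineMap (A B P Q : Plane) (t : ℝ) :
    orient A B (AffineMap.lineMap P Q t) = (1 - t) * orient A B P + t * orient A B Q := by
  simp [orient, AffineMap.lineMap_apply]; ring

/-- The three-term Grassmann–Plücker relation. -/
theorem orient_plucker (H K A B C : Plane) :
    orient H K A * orient H B C - orient H K B * orient H A C +
      orient H K C * orient H A B = 0 := by
  unfold orient; ring

theorem mem_line_iff_orient_eq_zero {A B : Plane} (h : A ≠ B) (C : Plane) :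
    C ∈ line[ℝ, A, B] ↔ orient A B C = 0 := by
  rw [mem_affineSpan_pair_iff_exists_lineMap_eq]
  constructor
  · rintro ⟨t, rfl⟩
    simp [orient_lineMap]
  · intro h0
    unfold orient at h0
    by_cases hx : B 0 - A 0 = 0
    · have hy : B 1 - A 1 ≠ 0 := by
        intro hy
        apply h
        ext i
        fin_cases i
        · simpa using (sub_eq_zero.1 hx).symm
        · simpa using (sub_eq_zero.1 hy).symm
      have hc : C 0 - A 0 = 0 := by
        rw [hx] at h0
        simpa [hy] using h0
      refine ⟨(C 1 - A 1) / (B 1 - A 1), ?_⟩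
      ext i
      fin_cases i
      · simp [AffineMap.lineMap_apply, hx]; linarith
      · simp [AffineMap.lineMap_apply, hy]
    · refine ⟨(C 0 - A 0) / (B 0 - A 0), ?_⟩
      ext i
      fin_cases i
      · simp [AffineMap.lineMap_apply, hx]
      · simp [AffineMap.lineMap_apply]
        field_simp
        linarith

theorem collinear_iff_orient_eq_zero {A B : Plane} (h : A ≠ B) (C : Plane) :
    Collinear ℝ {A, B, C} ↔ orient A B C = 0 := by
  rw [← mem_line_iff_orient_eq_zero h]
  constructor
  · intro hc
    exact hc.mem_affineSpan_of_mem_of_ne (by simp) (by simp) (by simp) h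
  · intro hc
    have := collinear_insert_of_mem_affineSpan_pair hc
    convert this using 1
    ext x; simp; tauto

theorem sOppSide_line_iff {A B : Plane} (h : A ≠ B) (P Q : Plane) :
    line[ℝ, A, B].SOppSide P Q ↔ orient A B P * orient A B Q < 0 := by
  rw [AffineSubspace.SOppSide, AffineSubspace.wOppSide_iff_exists_wbtw,
    mem_line_iff_orient_eq_zero h, mem_line_iff_orient_eq_zero h]
  constructor
  · rintro ⟨⟨p, hp, t, ⟨ht0, ht1⟩, rfl⟩, hP, hQ⟩
    rw [mem_line_iff_orient_eq_zero h, orient_lineMap] at hp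
    by_contra hn
    rcases (not_lt.1 hn).lt_or_eq with h1 | h1
    · rcases pos_and_pos_or_neg_and_neg_of_mul_pos h1 with ⟨a, b⟩ | ⟨a, b⟩ <;>
        rcases ht0.lt_or_eq with h2 | h2
      · nlinarith [mul_pos h2 b, mul_nonneg (sub_nonneg.2 ht1) a.le]
      · subst h2; simp at hp; exact hP hp
      · nlinarith [mul_neg_of_pos_of_neg h2 b, mul_nonneg (sub_nonneg.2 ht1) (neg_pos.2 a).le]
      · subst h2; simp at hp; exact hP hp
    · exact (mul_ne_zero hP hQ) h1.symm
  · intro hn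
    have hP : orient A B P ≠ 0 := by rintro h0; simp [h0] at hn
    have hQ : orient A B Q ≠ 0 := by rintro h0; simp [h0] at hn
    have hd : orient A B P - orient A B Q ≠ 0 := by
      intro h0
      rw [sub_eq_zero.1 h0] at hn
      exact absurd hn (not_lt.2 (mul_self_nonneg _))
    refine ⟨⟨AffineMap.lineMap P Q (orient A B P / (orient A B P - orient A B Q)), ?_, _,
      ⟨?_, ?_⟩, rfl⟩, hP, hQ⟩
    · rw [mem_line_iff_orient_eq_zero h, orient_lineMap]
      field_simp
      ring
    · rcases mul_neg_iff.1 hn with ⟨a, b⟩ | ⟨a, b⟩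
      · exact div_nonneg a.le (by linarith)
      · exact div_nonneg_of_nonpos a.le (by linarith)
    · rcases mul_neg_iff.1 hn with ⟨a, b⟩ | ⟨a, b⟩
      · rw [div_le_one (by linarith)]; linarith
      · rw [div_le_one_of_neg (by linarith)]; linarith

/-! ### Counting separating lines by orientations -/

namespace RectilinearDrawing

variable {V : Type*} (R : RectilinearDrawing V)

theorem orient_ne_zero {a b c : V} (hab : a ≠ b) (hac : a ≠ c) (hbc : b ≠ c) :
    orient (R.pos a) (R.pos b) (R.pos c) ≠ 0 := by
  have hi := R.injective_pos
  rw [Ne, ← collinear_iff_orient_eq_zero (hi.ne hab)]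
  exact R.generic_range _ ⟨a, rfl⟩ _ ⟨b, rfl⟩ _ ⟨c, rfl⟩ (hi.ne hab) (hi.ne hac) (hi.ne hbc)

/-- A drawing from positions without degenerate triples. -/
def ofOrient (pos : V → Plane) (hV : ∀ a b : V, ∃ c, a ≠ c ∧ b ≠ c)
    (h : ∀ a b c, a ≠ b → a ≠ c → b ≠ c → orient (pos a) (pos b) (pos c) ≠ 0) :
    RectilinearDrawing V where
  pos := pos
  injective_pos := by
    intro a b hab
    by_contra hne
    obtain ⟨c, hac, hbc⟩ := hV a b
    exact h a b c hne hac hbc (by rw [hab]; simp)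
  generic_range := by
    rintro _ ⟨a, rfl⟩ _ ⟨b, rfl⟩ _ ⟨c, rfl⟩ hab hac hbc
    rw [collinear_iff_orient_eq_zero hab]
    exact h a b c (ne_of_apply_ne _ hab) (ne_of_apply_ne _ hac) (ne_of_apply_ne _ hbc)

theorem line_eq_line_iff {a b c d : V} (hab : a ≠ b) (hcd : c ≠ d) :
    line[ℝ, R.pos a, R.pos b] = line[ℝ, R.pos c, R.pos d] ↔
      (a = c ∧ b = d) ∨ (a = d ∧ b = c) := by
  constructor
  · intro h
    have key : ∀ x : V, R.pos x ∈ line[ℝ, R.pos a, R.pos b] → x = a ∨ x = b := by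
      intro x hx
      by_contra hn
      push Not at hn
      rw [mem_line_iff_orient_eq_zero (R.injective_pos.ne hab)] at hx
      exact R.orient_ne_zero hab hn.1.symm hn.2.symm hx
    have hc := key c (h ▸ left_mem_affineSpan_pair ℝ _ _)
    have hd := key d (h ▸ right_mem_affineSpan_pair ℝ _ _)
    rcases hc with rfl | rfl <;> rcases hd with rfl | rfl <;> simp_all
  · rintro (⟨rfl, rfl⟩ | ⟨rfl, rfl⟩)
    · rfl
    · rw [Set.pair_comm]

/-- By genericity each separating line comes from exactly two ordered pairs of vertices, whence the
factor 2. No restriction on the pairs is needed: a pair that is equal or meets `s` or `t` gives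
product 0. -/
theorem two_mul_separationNumber [Fintype V] (s t : V) :
    2 * separationNumber (Set.range R.pos) (R.pos s) (R.pos t) =
      ∑ a : V, ∑ b : V, if orient (R.pos a) (R.pos b) (R.pos s) *
        orient (R.pos a) (R.pos b) (R.pos t) < 0 then 1 else 0 := by
  classical
  set F : Finset (V × V) := {x | orient (R.pos x.1) (R.pos x.2) (R.pos s) *
        orient (R.pos x.1) (R.pos x.2) (R.pos t) < 0} with hF
  let f : V × V → AffineSubspace ℝ Plane := fun x => line[ℝ, R.pos x.1, R.pos x.2]
  have hne : ∀ x ∈ F, x.1 ≠ x.2 := by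
    rintro ⟨a, b⟩ hx hab
    simp only at hab
    subst hab
    simp [hF] at hx
  have himg : {L ∈ definedLines (Set.range R.pos \ {R.pos s, R.pos t}) |
      L.SOppSide (R.pos s) (R.pos t)} = (F.image f : Finset _) := by
    ext L
    simp only [definedLines, Set.mem_ofPred_eq, Finset.coe_image, Set.mem_image, Finset.mem_coe]
    constructor
    · rintro ⟨⟨_, ⟨⟨a, rfl⟩, -⟩, _, ⟨⟨b, rfl⟩, -⟩, hab, rfl⟩, hL⟩
      rw [sOppSide_line_iff hab] at hL
      exact ⟨(a, b), by simpa [hF] using hL, rfl⟩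
    · rintro ⟨⟨a, b⟩, hx, rfl⟩
      have hab := hne _ hx
      simp only [hF, Finset.mem_filter, Finset.mem_univ, true_and] at hx
      refine ⟨⟨R.pos a, ⟨⟨a, rfl⟩, ?_⟩, R.pos b, ⟨⟨b, rfl⟩, ?_⟩, R.injective_pos.ne hab, rfl⟩,
        (sOppSide_line_iff (R.injective_pos.ne hab) _ _).2 hx⟩
      · rintro (h | h) <;> rw [h] at hx <;> simp at hx
      · rintro (h | h) <;> rw [h] at hx <;> simp at hx
  rw [separationNumber, himg, Set.ncard_coe_finset, ← Fintype.sum_prod_type'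
    (f := fun a b => if orient (R.pos a) (R.pos b) (R.pos s) *
        orient (R.pos a) (R.pos b) (R.pos t) < 0 then 1 else 0), ← Finset.card_filter, ← hF,
    Finset.card_eq_sum_card_image f F, mul_comm]
  symm
  apply Finset.sum_const_nat
  intro L hL
  obtain ⟨⟨a, b⟩, hx, rfl⟩ := Finset.mem_image.1 hL
  have hab : a ≠ b := hne _ hx
  have : F.filter (fun y => f y = f (a, b)) = {(a, b), (b, a)} := by
    ext ⟨c, d⟩
    simp only [Finset.mem_filter, Finset.mem_insert, Finset.mem_singleton, Prod.mk.injEq]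
    constructor
    · rintro ⟨hc, h⟩
      exact (R.line_eq_line_iff (hne _ hc) hab).1 h
    · rintro (⟨rfl, rfl⟩ | ⟨rfl, rfl⟩)
      · exact ⟨hx, rfl⟩
      · refine ⟨?_, (R.line_eq_line_iff hab.symm hab).2 (Or.inr ⟨rfl, rfl⟩)⟩
        simpa [hF, orient_swap_left (R.pos d) (R.pos c)] using hx
  rw [this, Finset.card_pair]
  simp [hab]

end RectilinearDrawing

/-! ### Spokes and rim of the wheel -/

theorem Fin.val_add_one_eq_ite {n : ℕ} [NeZero n] (i : Fin n) :
    ((i + 1 : Fin n) : ℕ) = if (i : ℕ) + 1 = n then 0 else (i : ℕ) + 1 := by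
  have hi := i.isLt
  rw [Fin.val_add, Fin.val_one', Nat.add_mod_mod]
  split_ifs with h
  · rw [h, Nat.mod_self]
  · exact Nat.mod_eq_of_lt (by omega)

theorem wheelGraph_edgeFinset {n : ℕ} [NeZero n] (hn : 3 ≤ n)
    [Fintype (wheelGraph n).edgeSet] [DecidableEq (Fin n ⊕ Fin 1)] :
    (wheelGraph n).edgeFinset =
      Finset.univ.image (fun i : Fin n => s(Sum.inr 0, Sum.inl i)) ∪
        Finset.univ.image (fun i : Fin n => s(Sum.inl i, Sum.inl (i + 1))) := by
  obtain ⟨m, rfl⟩ := Nat.exists_eq_add_of_le' hn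
  ext e
  induction e using Sym2.ind with
  | _ x y =>
    rw [SimpleGraph.mem_edgeFinset, SimpleGraph.mem_edgeSet, wheelGraph, SimpleGraph.sup_adj,
      SimpleGraph.map_adj]
    simp only [Finset.mem_union, Finset.mem_image, Finset.mem_univ, true_and,
      SimpleGraph.cycleGraph_adj]
    rcases x with x | x <;> rcases y with y | y
    · simp only [Function.Embedding.inl_apply, Sum.inl.injEq, Sym2.eq_iff, reduceCtorEq,
        false_and, or_false, exists_false, false_or, completeBipartiteGraph_adj,
        Sum.isLeft_inl, Sum.isRight_inl, Bool.false_eq_true, and_false]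
      constructor
      · rintro ⟨u, v, h, rfl, rfl⟩
        rcases h with h | h
        · exact ⟨v, Or.inr ⟨rfl, by rw [← h]; abel⟩⟩
        · exact ⟨u, Or.inl ⟨rfl, by rw [← h]; abel⟩⟩
      · rintro ⟨i, ⟨rfl, rfl⟩ | ⟨rfl, rfl⟩⟩
        · exact ⟨_, _, Or.inr (by abel), rfl, rfl⟩
        · exact ⟨_, _, Or.inl (by abel), rfl, rfl⟩
    · simp [Subsingleton.elim y 0]
    · simp [Subsingleton.elim x 0]
    · simp

namespace RectilinearDrawing

variable {n : ℕ} (R : RectilinearDrawing (Fin n ⊕ Fin 1))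

/-- The sum of `n(s, t)` over the spokes. -/
noncomputable def spokeCrossings : ℕ :=
  ∑ i : Fin n,
    separationNumber (Set.range R.pos) (R.pos (Sum.inr 0)) (R.pos (Sum.inl i))

/-- The sum of `n(s, t)` over the edges of the rim. -/
noncomputable def rimCrossings [NeZero n] : ℕ :=
  ∑ i : Fin n,
    separationNumber (Set.range R.pos) (R.pos (Sum.inl i)) (R.pos (Sum.inl (i + 1)))

theorem crossingNumber_wheelGraph [NeZero n] (hn : 3 ≤ n) :
    R.crossingNumber (wheelGraph n) = R.spokeCrossings + R.rimCrossings := by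
  classical
  rw [crossingNumber, wheelGraph_edgeFinset hn, Finset.sum_union, Finset.sum_image,
    Finset.sum_image]
  · rfl
  · intro i _ j _ h
    simp only [Sym2.eq_iff, Sum.inl.injEq] at h
    rcases h with h | ⟨rfl, h⟩
    · exact h.1
    -- Equal edges with swapped endpoints would force `j + 2 = j` modulo `n`, impossible for `n ≥
    -- 3`.
    · have h1 := congrArg Fin.val h
      rw [Fin.val_add_one_eq_ite, Fin.val_add_one_eq_ite] at h1
      have := j.isLt
      split_ifs at h1 <;> omega
  · intro i _ j _ h
    simpa using h
  · rw [Finset.disjoint_left]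
    simp

theorem crossingNumber_starGraph : R.crossingNumber (starGraph n) = R.spokeCrossings := by
  classical
  have : (starGraph n).edgeFinset =
      Finset.univ.image (fun i : Fin n => s(Sum.inr 0, Sum.inl i)) := by
    ext e
    induction e using Sym2.ind with
    | _ x y =>
      simp only [SimpleGraph.mem_edgeFinset, SimpleGraph.mem_edgeSet, Finset.mem_image,
        Finset.mem_univ, true_and]
      rcases x with x | x <;> rcases y with y | y
      · simp
      · simp [Subsingleton.elim y 0]
      · simp [Subsingleton.elim x 0]
      · simp
  rw [crossingNumber, this, Finset.sum_image]
  · rfl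
  · intro i _ j _ h
    simpa using h

/-- The orientation of the triangle spanned by the hub and two leaves. -/
noncomputable def hubOrient (i j : Fin n) : ℝ :=
  orient (R.pos (Sum.inr 0)) (R.pos (Sum.inl i)) (R.pos (Sum.inl j))

theorem hubOrient_swap (i j : Fin n) : R.hubOrient j i = -R.hubOrient i j :=
  orient_swap _ _ _

@[simp] theorem hubOrient_self (i : Fin n) : R.hubOrient i i = 0 :=
  orient_self_right _ _

theorem hubOrient_ne_zero {i j : Fin n} (h : i ≠ j) : R.hubOrient i j ≠ 0 :=
  R.orient_ne_zero (by simp) (by simp) (by simpa using h)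

theorem orient_leaves (i j k : Fin n) :
    orient (R.pos (Sum.inl i)) (R.pos (Sum.inl j)) (R.pos (Sum.inl k)) =
      R.hubOrient i j + R.hubOrient j k + R.hubOrient k i :=
  orient_eq_add _ _ _ _

theorem hubOrient_add_ne_zero {i j k : Fin n} (hij : i ≠ j) (hik : i ≠ k) (hjk : j ≠ k) :
    R.hubOrient i j + R.hubOrient j k + R.hubOrient k i ≠ 0 := by
  rw [← orient_leaves]
  exact R.orient_ne_zero (by simpa using hij) (by simpa using hik) (by simpa using hjk)

/-- A line through the hub never separates the hub from a leaf, so only lines through two leaves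
count. Expanding the triangle of leaves around the hub leaves an expression in `hubOrient` alone. -/
theorem two_mul_spokeCrossings :
    2 * R.spokeCrossings = ∑ i : Fin n, ∑ j : Fin n, ∑ k : Fin n,
      if R.hubOrient i j * (R.hubOrient i j + R.hubOrient j k + R.hubOrient k i) < 0
        then 1 else 0 := by
  rw [spokeCrossings, Finset.mul_sum]
  simp only [two_mul_separationNumber, Fintype.sum_sum_type, Finset.univ_unique,
    Finset.sum_singleton, Fin.default_eq_zero, orient_self_right,
    orient_self_outer, zero_mul,
    lt_irrefl, if_false, add_zero, Finset.sum_const_zero]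
  rw [Finset.sum_comm]
  refine Finset.sum_congr rfl fun i _ => ?_
  rw [Finset.sum_comm]
  refine Finset.sum_congr rfl fun j _ => Finset.sum_congr rfl fun k _ => ?_
  rw [orient_leaves, ← orient_rotate]
  rfl

theorem two_mul_separationNumber_leaves (s t : Fin n) :
    2 * separationNumber (Set.range R.pos) (R.pos (Sum.inl s)) (R.pos (Sum.inl t)) =
      (∑ a : Fin n, ∑ b : Fin n,
        if orient (R.pos (Sum.inl a)) (R.pos (Sum.inl b)) (R.pos (Sum.inl s)) *
          orient (R.pos (Sum.inl a)) (R.pos (Sum.inl b)) (R.pos (Sum.inl t)) < 0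
          then 1 else 0) +
      2 * ∑ k : Fin n, if R.hubOrient k s * R.hubOrient k t < 0 then 1 else 0 := by
  rw [two_mul_separationNumber]
  simp only [Fintype.sum_sum_type, Finset.univ_unique,
    Finset.sum_singleton, Fin.default_eq_zero, orient_self_left, zero_mul,
    lt_irrefl, if_false, add_zero, Finset.sum_add_distrib]
  rw [two_mul, add_assoc]
  congr 1
  congr 1
  refine Finset.sum_congr rfl fun k _ => ?_
  rw [orient_swap_left (R.pos (Sum.inr 0)), orient_swap_left (R.pos (Sum.inr 0)), neg_mul_neg]
  rfl

end RectilinearDrawing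

/-! ### Counting triples in a weighted tournament -/

theorem sum_cyclic {ι : Type*} [Fintype ι] (f : ι → ι → ι → ℕ) :
    ∑ x, ∑ y, ∑ z, (f x y z + f y z x + f z x y) = 3 * ∑ x, ∑ y, ∑ z, f x y z := by
  have h1 : ∀ g : ι → ι → ι → ℕ,
      ∑ x, ∑ y, ∑ z, g y z x = ∑ x, ∑ y, ∑ z, g x y z := fun g => by
    rw [Finset.sum_comm]
    exact Finset.sum_congr rfl fun y _ => Finset.sum_comm
  have h2 := h1 fun x y z => f z x y
  simp only [Finset.sum_add_distrib, h1 f, ← h2]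
  ring

theorem sum_offDiag_ite {ι : Type*} [Fintype ι] (p : ι → Prop) [DecidablePred p]
    [DecidableEq ι] :
    (∑ y : ι, ∑ z : ι, if p y ∧ p z ∧ y ≠ z then 1 else 0) =
      (Finset.univ.filter p).card * (Finset.univ.filter p).card -
        (Finset.univ.filter p).card := by
  rw [← Finset.offDiag_card, ← Fintype.sum_prod_type'
    (f := fun y z => if p y ∧ p z ∧ y ≠ z then 1 else 0), ← Finset.card_filter]
  congr 1
  ext ⟨y, z⟩
  simp [Finset.mem_offDiag]

/-- Eight times the Orchard crossing number of the star with `n` leaves. -/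
def starBound (n : ℕ) : ℤ :=
  if Even n then (n : ℤ) * ((n : ℤ) - 2) ^ 2 else (n : ℤ) * ((n : ℤ) - 1) * ((n : ℤ) - 3)

theorem starBound_le_of_sum_eq {ι : Type*} [Fintype ι] (d : ι → ℤ)
    (h : 2 * ∑ i, d i = (Fintype.card ι : ℤ) * ((Fintype.card ι : ℤ) - 1)) :
    starBound (Fintype.card ι) ≤ 4 * ∑ i, (d i * d i - d i) := by
  set n := Fintype.card ι with hn
  have hc : ∀ c : ℤ, ∑ _i : ι, c = n * c := fun c => by simp [hn]
  unfold starBound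
  split_ifs with he
  · obtain ⟨m, hm⟩ := he
    -- The left side is the secant of `4(x² - x)` through the consecutive integers `m - 1` and `m`,
    -- where `n = 2m`; no integer lies strictly between them.
    have h1 : ∀ i ∈ Finset.univ, (4 * n - 8) * d i - n * (n - 2) ≤ 4 * (d i * d i - d i) := by
      intro i _
      have h2 : 0 ≤ (d i - m) * (d i - (m - 1)) := by
        rcases le_or_gt (m : ℤ) (d i) with h | h
        · exact mul_nonneg (by linarith) (by linarith)
        · exact mul_nonneg_of_nonpos_of_nonpos (by linarith) (by linarith [Int.le_sub_one_of_lt h])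
      rw [hm]
      push_cast
      nlinarith
    have h3 := Finset.sum_le_sum h1
    rw [Finset.sum_sub_distrib, hc, ← Finset.mul_sum, ← Finset.mul_sum] at h3
    refine le_trans (le_of_eq ?_) h3
    linear_combination (-(2 * (n : ℤ) - 4)) * h
  -- Here the mean outdegree `(n - 1) / 2` is an integer, and the tangent at it suffices.
  · have h1 : ∀ i ∈ Finset.univ, (4 * n - 8) * d i - (n - 1) ^ 2 ≤ 4 * (d i * d i - d i) := by
      intro i _
      nlinarith [sq_nonneg (2 * d i - (n - 1))]
    have h3 := Finset.sum_le_sum h1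
    rw [Finset.sum_sub_distrib, hc, ← Finset.mul_sum, ← Finset.mul_sum] at h3
    refine le_trans (le_of_eq ?_) h3
    linear_combination (-(2 * (n : ℤ) - 4)) * h

section Tournament

variable {ι : Type*} (w : ι → ι → ℝ)

/-- At a source `x` the terms `w x y` and `w z x` have opposite signs, so one of them disagrees with
the nonzero total. -/
theorem cyclic_lt_of_source (anti : ∀ i j, w j i = -w i j)
    (hs : ∀ i j k, i ≠ j → i ≠ k → j ≠ k → w i j + w j k + w k i ≠ 0) {x y z : ι}
    (hxy : 0 < w x y) (hxz : 0 < w x z) (hyz : y ≠ z) :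
    w x y * (w x y + w y z + w z x) < 0 ∨ w z x * (w x y + w y z + w z x) < 0 := by
  have h0 : ∀ i, w i i = 0 := fun i => by linarith [anti i i]
  have h1 : x ≠ y := by rintro rfl; simp [h0] at hxy
  have h2 : x ≠ z := by rintro rfl; simp [h0] at hxz
  have h3 : w z x < 0 := by rw [anti]; linarith
  rcases lt_or_gt_of_ne (hs x y z h1 h2 hyz) with h | h
  · exact Or.inl (mul_neg_of_pos_of_neg hxy h)
  · exact Or.inr (mul_neg_of_neg_of_pos h3 h)

variable [Fintype ι]

theorem two_mul_sum_outdegree (anti : ∀ i j, w j i = -w i j) (hw : ∀ i j, i ≠ j → w i j ≠ 0) :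
    2 * ∑ i, (Finset.univ.filter fun j => 0 < w i j).card =
      Fintype.card ι * Fintype.card ι - Fintype.card ι := by
  classical
  have h := sum_offDiag_ite (ι := ι) (fun _ => True)
  simp only [Finset.filter_true, Finset.card_univ, true_and] at h
  rw [← h]
  simp only [Finset.card_filter]
  rw [two_mul]
  nth_rewrite 2 [Finset.sum_comm]
  rw [← Finset.sum_add_distrib]
  refine Finset.sum_congr rfl fun i _ => ?_
  rw [← Finset.sum_add_distrib]
  refine Finset.sum_congr rfl fun j _ => ?_
  rw [anti i j]
  by_cases hij : i = j
  · subst hij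
    have : w i i = 0 := by linarith [anti i i]
    simp [this]
  · rcases lt_or_gt_of_ne (hw i j hij) with h | h
    · simp [hij, h, h.le]
    · simp [hij, h, h.le]

theorem starBound_le_sum (anti : ∀ i j, w j i = -w i j) (hw : ∀ i j, i ≠ j → w i j ≠ 0)
    (hs : ∀ i j k, i ≠ j → i ≠ k → j ≠ k → w i j + w j k + w k i ≠ 0) :
    starBound (Fintype.card ι) ≤ 4 * ((∑ i, ∑ j, ∑ k,
      if w i j * (w i j + w j k + w k i) < 0 then 1 else 0 : ℕ) : ℤ) := by
  classical
  set d : ι → ℕ := fun i => (Finset.univ.filter fun j => 0 < w i j).card with hd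
  have hsum := two_mul_sum_outdegree w anti hw
  have h1 := starBound_le_of_sum_eq (fun i => (d i : ℤ)) (by
    have : Fintype.card ι ≤ Fintype.card ι * Fintype.card ι := Nat.le_mul_self _
    zify [this] at hsum
    rw [hsum]; ring)
  refine h1.trans ?_
  have h2 : ∑ i, (d i * d i - d i) ≤
      ∑ i, ∑ j, ∑ k, if w i j * (w i j + w j k + w k i) < 0 then 1 else 0 := by
    have h3 : ∀ i, d i * d i - d i =
        ∑ j, ∑ k, if 0 < w i j ∧ 0 < w i k ∧ j ≠ k then 1 else 0 :=
      fun i => (sum_offDiag_ite (fun j => 0 < w i j)).symm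
    simp only [h3]
    -- Averaging over the rotations of a triple makes a termwise comparison possible: at most one of
    -- its three vertices is a source.
    refine Nat.le_of_mul_le_mul_left (c := 3) ?_ (by norm_num)
    rw [← sum_cyclic, ← sum_cyclic]
    refine Finset.sum_le_sum fun x _ => Finset.sum_le_sum fun y _ =>
      Finset.sum_le_sum fun z _ => ?_
    have key := @cyclic_lt_of_source _ w anti hs
    have e1 : w y z + w z x + w x y = w x y + w y z + w z x := by ring
    have e2 : w z x + w x y + w y z = w x y + w y z + w z x := by ring
    rw [e1, e2]
    have a1 := anti x y
    have a2 := anti y z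
    have a3 := anti z x
    have k1 := @key x y z
    have k2 := @key y z x
    have k3 := @key z x y
    rw [e1] at k2
    rw [e2] at k3
    by_cases c1 : 0 < w x y ∧ 0 < w x z ∧ y ≠ z
    · have c2 : ¬ (0 < w y z ∧ 0 < w y x ∧ z ≠ x) := fun h => by linarith [h.2.1, c1.1]
      have c3 : ¬ (0 < w z x ∧ 0 < w z y ∧ x ≠ y) := fun h => by linarith [h.1, c1.2.1]
      rw [if_pos c1, if_neg c2, if_neg c3]
      rcases k1 c1.1 c1.2.1 c1.2.2 with h | h <;> rw [if_pos h] <;> omega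
    · by_cases c2 : 0 < w y z ∧ 0 < w y x ∧ z ≠ x
      · have c3 : ¬ (0 < w z x ∧ 0 < w z y ∧ x ≠ y) := fun h => by linarith [h.2.1, c2.1]
        rw [if_neg c1, if_pos c2, if_neg c3]
        rcases k2 c2.1 c2.2.1 c2.2.2 with h | h <;> rw [if_pos h] <;> omega
      · by_cases c3 : 0 < w z x ∧ 0 < w z y ∧ x ≠ y
        · rw [if_neg c1, if_neg c2, if_pos c3]
          rcases k3 c3.1 c3.2.1 c3.2.2 with h | h <;> rw [if_pos h] <;> omega
        · rw [if_neg c1, if_neg c2, if_neg c3]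
          omega
  have h4 : ∀ i, ((d i * d i - d i : ℕ) : ℤ) = (d i : ℤ) * d i - d i := fun i => by
    rw [Nat.cast_sub (Nat.le_mul_self _)]; push_cast; ring
  simp only [← h4]
  rw [← Nat.cast_sum]
  exact_mod_cast Nat.mul_le_mul_left 4 h2

/-- If every triple is acyclic, then every triple contributes to the sum. -/
theorem card_mul_le_sum [DecidableEq ι] (hw : ∀ i j, i ≠ j → w i j ≠ 0)
    (hs : ∀ i j k, i ≠ j → i ≠ k → j ≠ k → w i j + w j k + w k i ≠ 0)
    (hpos : ∀ i j k, ¬ (0 < w i j ∧ 0 < w j k ∧ 0 < w k i))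
    (hneg : ∀ i j k, ¬ (w i j < 0 ∧ w j k < 0 ∧ w k i < 0)) :
    (∑ i : ι, ∑ j : ι, ∑ k : ι, if i ≠ j ∧ i ≠ k ∧ j ≠ k then 1 else 0) ≤
      3 * ∑ i, ∑ j, ∑ k, if w i j * (w i j + w j k + w k i) < 0 then 1 else 0 := by
  rw [← sum_cyclic]
  refine Finset.sum_le_sum fun x _ => Finset.sum_le_sum fun y _ => Finset.sum_le_sum fun z _ => ?_
  have e1 : w y z + w z x + w x y = w x y + w y z + w z x := by ring
  have e2 : w z x + w x y + w y z = w x y + w y z + w z x := by ring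
  rw [e1, e2]
  by_cases c : x ≠ y ∧ x ≠ z ∧ y ≠ z
  · obtain ⟨hxy, hxz, hyz⟩ := c
    have h1 := hw _ _ hxy
    have h2 := hw _ _ hyz
    have h3 := hw _ _ hxz.symm
    have : w x y * (w x y + w y z + w z x) < 0 ∨ w y z * (w x y + w y z + w z x) < 0 ∨
        w z x * (w x y + w y z + w z x) < 0 := by
      have hp := hpos x y z
      have hn := hneg x y z
      rcases lt_or_gt_of_ne (hs x y z hxy hxz hyz) with h | h
      · simp only [mul_neg_iff, h, h.not_gt, and_true, and_false, or_false]
        by_contra hc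
        push Not at hc
        exact hn ⟨lt_of_le_of_ne hc.1 h1, lt_of_le_of_ne hc.2.1 h2, lt_of_le_of_ne hc.2.2 h3⟩
      · simp only [mul_neg_iff, h, h.not_gt, and_true, and_false, false_or]
        by_contra hc
        push Not at hc
        exact hp ⟨lt_of_le_of_ne hc.1 h1.symm, lt_of_le_of_ne hc.2.1 h2.symm,
          lt_of_le_of_ne hc.2.2 h3.symm⟩
    rw [if_pos ⟨hxy, hxz, hyz⟩]
    rcases this with h | h | h <;> rw [if_pos h] <;> omega
  · rw [if_neg c]
    omega

end Tournament

theorem sum_distinct_triples {ι : Type*} [Fintype ι] [DecidableEq ι] :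
    (∑ i : ι, ∑ j : ι, ∑ k : ι, if i ≠ j ∧ i ≠ k ∧ j ≠ k then 1 else 0) =
      Fintype.card ι * ((Fintype.card ι - 1) * (Fintype.card ι - 1) - (Fintype.card ι - 1)) := by
  have : ∀ i : ι, (Finset.univ.filter fun j => i ≠ j).card = Fintype.card ι - 1 := fun i => by
    rw [← Finset.card_univ, ← Finset.card_erase_of_mem (Finset.mem_univ i)]
    congr 1
    ext j
    simp [eq_comm]
  simp only [sum_offDiag_ite, this]
  simp

/-- Walk around the cycle from `k + 1` to `k - 1`. This avoids `k`, where `g` may vanish; without a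
sign change at some step, all values would share the sign of `g (k + 1)`. -/
theorem exists_mul_succ_neg {n : ℕ} [NeZero n] (g : Fin n → ℝ) (k : Fin n)
    (hg : ∀ j, j ≠ k → g j ≠ 0) {a b : Fin n} (hak : a ≠ k) (hbk : b ≠ k)
    (ha : 0 < g a) (hb : g b < 0) : ∃ i, g i * g (i + 1) < 0 := by
  by_contra! hc
  have hne : ∀ t, 0 < t → t < n → g (k + Fin.ofNat n t) ≠ 0 := by
    intro t ht htn
    apply hg
    intro h
    have h1 := congrArg Fin.val (add_eq_left.1 h)
    simp [Nat.mod_eq_of_lt htn] at h1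
    omega
  have hsign : ∀ t, t + 1 < n →
      0 < g (k + Fin.ofNat n 1) * g (k + Fin.ofNat n (t + 1)) := by
    intro t
    induction t with
    | zero =>
      intro h
      exact mul_self_pos.2 (hne 1 one_pos h)
    | succ t ih =>
      intro h
      have h1 := ih (by omega)
      have h2 := hc (k + Fin.ofNat n (t + 1))
      have h3 : k + Fin.ofNat n (t + 1) + 1 = k + Fin.ofNat n (t + 1 + 1) := by
        rw [add_assoc]
        congr 1
        ext
        simp [Fin.val_add]
      rw [h3] at h2
      have n1 := hne (t + 1) (by omega) (by omega)
      have n2 := hne (t + 1 + 1) (by omega) (by omega)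
      have h4 := lt_of_le_of_ne h2 (mul_ne_zero n1 n2).symm
      have h5 := mul_pos h1 h4
      have h6 := mul_self_pos.2 n1
      by_contra h7
      nlinarith [mul_nonneg h6.le (neg_nonneg.2 (not_lt.1 h7))]
  have hall : ∀ j, j ≠ k → 0 < g (k + Fin.ofNat n 1) * g j := by
    intro j hj
    have h1 : k + Fin.ofNat n ((j - k : Fin n) : ℕ) = j := by
      have : Fin.ofNat n ((j - k : Fin n) : ℕ) = j - k := by
        ext; simp
      rw [this]; abel
    have h2 : ((j - k : Fin n) : ℕ) ≠ 0 := by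
      intro h
      rw [h] at h1
      apply hj
      rw [← h1]
      ext; simp
    obtain ⟨t, ht⟩ := Nat.exists_eq_succ_of_ne_zero h2
    have h3 := hsign t (by have := (j - k).isLt; omega)
    rw [ht] at h1
    rwa [← h1]
  have h1 := hall a hak
  have h2 := hall b hbk
  nlinarith [mul_pos ha (neg_pos.2 hb), (pos_iff_pos_of_mul_pos h1).2 ha]

/-! ### The lower bound for every drawing -/

namespace RectilinearDrawing

variable {n : ℕ} (R : RectilinearDrawing (Fin n ⊕ Fin 1))

theorem starBound_le_spokeCrossings : starBound n ≤ 8 * (R.spokeCrossings : ℤ) := by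
  have h := starBound_le_sum R.hubOrient R.hubOrient_swap (fun _ _ => R.hubOrient_ne_zero)
    (fun _ _ _ => R.hubOrient_add_ne_zero)
  rw [← two_mul_spokeCrossings, Fintype.card_fin] at h
  push_cast at h
  linarith

theorem le_rimCrossings [NeZero n]
    (h : ∀ k, (∃ a, 0 < R.hubOrient k a) ∧ ∃ b, R.hubOrient k b < 0) : n ≤ R.rimCrossings := by
  refine Nat.le_of_mul_le_mul_left (c := 2) ?_ (by norm_num)
  rw [rimCrossings, Finset.mul_sum]
  simp only [two_mul_separationNumber_leaves]
  rw [Finset.sum_add_distrib, ← Finset.mul_sum, Finset.sum_comm (f := fun i k =>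
    if R.hubOrient k i * R.hubOrient k (i + 1) < 0 then 1 else 0)]
  refine le_trans ?_ (Nat.le_add_left _ _)
  refine Nat.mul_le_mul_left _ ?_
  have : ∀ k ∈ Finset.univ,
      1 ≤ ∑ i : Fin n, if R.hubOrient k i * R.hubOrient k (i + 1) < 0 then 1 else 0 := by
    intro k _
    obtain ⟨⟨a, ha⟩, b, hb⟩ := h k
    have hne : ∀ {j}, R.hubOrient k j ≠ 0 → j ≠ k := by
      rintro j hj rfl
      simp at hj
    obtain ⟨i, hi⟩ := exists_mul_succ_neg (R.hubOrient k) k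
      (fun j hj => R.hubOrient_ne_zero hj.symm) (hne ha.ne') (hne hb.ne) ha hb
    rw [← Finset.card_filter, Nat.one_le_iff_ne_zero, Finset.card_ne_zero]
    exact ⟨i, by simpa using hi⟩
  simpa using Finset.sum_le_sum this

/-- A cyclic triple would have the hub inside its triangle, so its leaves could not all lie weakly
on one side of the line from the hub through `k`. Hence every triple is acyclic and contributes. -/
theorem card_le_spokeCrossings {k : Fin n}
    (hk : (∀ a, 0 ≤ R.hubOrient k a) ∨ ∀ a, R.hubOrient k a ≤ 0) :
    (n : ℤ) * (n - 1) * (n - 2) ≤ 6 * R.spokeCrossings := by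
  have hp : ∀ a b c, R.hubOrient k a * R.hubOrient b c - R.hubOrient k b * R.hubOrient a c +
      R.hubOrient k c * R.hubOrient a b = 0 := fun a b c => orient_plucker _ _ _ _ _
  have hpos : ∀ a b c, R.hubOrient a b * R.hubOrient b c > 0 →
      R.hubOrient a b * R.hubOrient c a > 0 → False := by
    intro a b c h1 h2
    have hc := hp a b c
    rw [R.hubOrient_swap c a] at hc
    have hab : a ≠ b := by rintro rfl; simp at h1
    have hzero : R.hubOrient k a ≠ 0 ∨ R.hubOrient k b ≠ 0 := by
      by_cases hka : k = a
      · exact Or.inr (R.hubOrient_ne_zero (hka ▸ hab))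
      · exact Or.inl (R.hubOrient_ne_zero hka)
    have h0 : 0 < R.hubOrient a b * R.hubOrient a b := by
      apply mul_self_pos.2
      rintro h
      simp [h] at h1
    -- For a cyclic triple this is a vanishing combination, with positive coefficients, of three
    -- numbers of the same weak sign. They cannot all be zero, since `a ≠ b` and only `hubOrient k
    -- k` vanishes.
    have hc' : R.hubOrient k a * (R.hubOrient a b * R.hubOrient b c) +
      R.hubOrient k b * (R.hubOrient a b * R.hubOrient c a) +
      R.hubOrient k c * (R.hubOrient a b * R.hubOrient a b) = 0 := by
        linear_combination R.hubOrient a b * hc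
    rcases hk with hk | hk
    · have t1 := mul_nonneg (hk a) h1.le
      have t2 := mul_nonneg (hk b) h2.le
      have t3 := mul_nonneg (hk c) h0.le
      rcases hzero with hz | hz
      · linarith [mul_pos (lt_of_le_of_ne (hk a) hz.symm) h1]
      · linarith [mul_pos (lt_of_le_of_ne (hk b) hz.symm) h2]
    · have t1 := mul_nonneg (neg_nonneg.2 (hk a)) h1.le
      have t2 := mul_nonneg (neg_nonneg.2 (hk b)) h2.le
      have t3 := mul_nonneg (neg_nonneg.2 (hk c)) h0.le
      rcases hzero with hz | hz
      · linarith [mul_pos (neg_pos.2 (lt_of_le_of_ne (hk a) hz)) h1]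
      · linarith [mul_pos (neg_pos.2 (lt_of_le_of_ne (hk b) hz)) h2]
  have h := card_mul_le_sum R.hubOrient (fun _ _ => R.hubOrient_ne_zero)
    (fun _ _ _ => R.hubOrient_add_ne_zero)
    (fun a b c h => hpos a b c (mul_pos h.1 h.2.1) (mul_pos h.1 h.2.2))
    (fun a b c h => hpos a b c (mul_pos_of_neg_of_neg h.1 h.2.1)
      (mul_pos_of_neg_of_neg h.1 h.2.2))
  rw [← two_mul_spokeCrossings, sum_distinct_triples, Fintype.card_fin] at h
  have hn : 1 ≤ n := by have := k.isLt; omega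
  have h2 : n - 1 ≤ (n - 1) * (n - 1) := Nat.le_mul_self _
  zify [hn, h2] at h
  linarith

theorem starBound_add_le (hn : 5 ≤ n) :
    starBound n + 8 * n ≤ 8 * (R.crossingNumber (wheelGraph n) : ℤ) := by
  have : NeZero n := ⟨by omega⟩
  rw [R.crossingNumber_wheelGraph (by omega)]
  push_cast
  by_cases h : ∀ k, (∃ a, 0 < R.hubOrient k a) ∧ ∃ b, R.hubOrient k b < 0
  · have h1 := R.starBound_le_spokeCrossings
    have h2 : (n : ℤ) ≤ R.rimCrossings := by exact_mod_cast R.le_rimCrossings h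
    linarith
  · push Not at h
    obtain ⟨k, hk⟩ := h
    have hk' : (∀ a, 0 ≤ R.hubOrient k a) ∨ ∀ a, R.hubOrient k a ≤ 0 := by
      by_cases hc : ∃ a, 0 < R.hubOrient k a
      · exact Or.inl (hk hc)
      · exact Or.inr (by simpa using hc)
    have h1 := R.card_le_spokeCrossings hk'
    -- The difference of the two sides is `n(n² - 28)` for even and `n(n² - 25)` for odd `n`. This
    -- is where `n ≥ 5` matters, with equality at `n = 5`.
    have h2 : 3 * (starBound n + 8 * n) ≤ 4 * ((n : ℤ) * (n - 1) * (n - 2)) := by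
      have h5 : (5 : ℤ) ≤ n := by exact_mod_cast hn
      unfold starBound
      split_ifs with he
      · have h6 : (6 : ℤ) ≤ n := by
          obtain ⟨m, hm⟩ := he
          omega
        have : 0 ≤ (n : ℤ) * ((n : ℤ) ^ 2 - 28) := mul_nonneg (by omega) (by nlinarith)
        linarith
      · have : 0 ≤ (n : ℤ) * ((n : ℤ) ^ 2 - 25) := mul_nonneg (by omega) (by nlinarith)
        linarith
    have h3 : (0 : ℤ) ≤ R.rimCrossings := Int.natCast_nonneg _
    linarith

end RectilinearDrawing

/-! ### Trigonometry of the regular polygon -/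

/-- The point with polar coordinates `(r, x)` around `c`. -/
noncomputable def polarPoint (c : Plane) (r x : ℝ) : Plane :=
  c + r • !₂[Real.cos x, Real.sin x]

theorem orient_polarPoint_center (c : Plane) (r s x y : ℝ) :
    orient c (polarPoint c r x) (polarPoint c s y) = r * s * Real.sin (y - x) := by
  simp [orient, polarPoint, Real.sin_sub]
  ring

/-- This rests on `sin 2a + sin 2b - sin 2(a + b) = 4 sin a sin b sin (a + b)`. The product form
exhibits the sign, hence the convex position of the polygon. -/
theorem orient_polarPoint (c : Plane) (r x y z : ℝ) :
    orient (polarPoint c r x) (polarPoint c r y) (polarPoint c r z) =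
      4 * r ^ 2 * (Real.sin ((y - x) / 2) * Real.sin ((z - y) / 2) * Real.sin ((z - x) / 2)) := by
  rw [orient_eq_add c]
  simp only [orient_polarPoint_center]
  have hy : y - x = 2 * ((y - x) / 2) := by ring
  have hz : z - y = 2 * ((z - y) / 2) := by ring
  have hx : x - z = -(2 * ((y - x) / 2 + (z - y) / 2)) := by ring
  have hs : (z - x) / 2 = (y - x) / 2 + (z - y) / 2 := by ring
  rw [hx, hs]
  nth_rewrite 1 [hy]
  nth_rewrite 1 [hz]
  generalize (y - x) / 2 = a
  generalize (z - y) / 2 = b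
  rw [Real.sin_neg, Real.sin_two_mul, Real.sin_two_mul, Real.sin_two_mul, Real.sin_add,
    Real.cos_add]
  have ha := Real.sin_sq_add_cos_sq a
  have hb := Real.sin_sq_add_cos_sq b
  linear_combination (-2 * r ^ 2 * Real.sin b * Real.cos b) * ha -
    2 * r ^ 2 * Real.sin a * Real.cos a * hb

/-- The angles of the vertices of a regular polygon. -/
noncomputable def polygonAngle (n : ℕ) (θ : ℝ) (i : ℕ) : ℝ := θ + 2 * Real.pi * (i : ℝ) / n

theorem polygonAngle_sub {n : ℕ} (θ : ℝ) (i j : ℕ) :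
    polygonAngle n θ j - polygonAngle n θ i = 2 * (Real.pi * ((j : ℝ) - i) / n) := by
  unfold polygonAngle; ring

theorem sin_half_polygonAngle_pos {n : ℕ} (θ : ℝ) {i j : ℕ} (hij : i < j) (hj : j < n) :
    0 < Real.sin ((polygonAngle n θ j - polygonAngle n θ i) / 2) := by
  have hn : (0 : ℝ) < n := by exact_mod_cast (by omega : 0 < n)
  have h1 : (i : ℝ) < j := by exact_mod_cast hij
  have h2 : (j : ℝ) < n := by exact_mod_cast hj
  have h3 : (0 : ℝ) ≤ i := Nat.cast_nonneg _
  rw [polygonAngle_sub, mul_div_cancel_left₀ _ two_ne_zero]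
  apply Real.sin_pos_of_pos_of_lt_pi
  · exact div_pos (mul_pos Real.pi_pos (by linarith)) hn
  · rw [div_lt_iff₀ hn]
    exact mul_lt_mul_of_pos_left (by linarith) Real.pi_pos

theorem sin_half_polygonAngle_ne_zero {n : ℕ} (θ : ℝ) {i j : ℕ} (hij : i ≠ j) (hi : i < n)
    (hj : j < n) : Real.sin ((polygonAngle n θ j - polygonAngle n θ i) / 2) ≠ 0 := by
  rcases lt_or_gt_of_ne hij with h | h
  · exact (sin_half_polygonAngle_pos θ h hj).ne'
  · rw [← neg_sub, neg_div, Real.sin_neg]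
    exact neg_ne_zero.2 (sin_half_polygonAngle_pos θ h hi).ne'

theorem sin_polygonAngle_pos {n : ℕ} (θ : ℝ) {i j : ℕ} (hij : i < j) (hj : 2 * (j - i) < n) :
    0 < Real.sin (polygonAngle n θ j - polygonAngle n θ i) := by
  have hn : (0 : ℝ) < n := by exact_mod_cast (by omega : 0 < n)
  have h1 : (i : ℝ) < j := by exact_mod_cast hij
  have h2 : 2 * ((j : ℝ) - i) < n := by
    rw [← Nat.cast_sub hij.le]; exact_mod_cast hj
  rw [polygonAngle_sub]
  apply Real.sin_pos_of_pos_of_lt_pi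
  · exact mul_pos two_pos (div_pos (mul_pos Real.pi_pos (by linarith)) hn)
  · rw [← mul_div_assoc, div_lt_iff₀ hn]
    nlinarith [mul_lt_mul_of_pos_left h2 Real.pi_pos]

theorem sin_polygonAngle_neg {n : ℕ} (θ : ℝ) {i j : ℕ} (hj : j < n) (hn2 : n < 2 * (j - i)) :
    Real.sin (polygonAngle n θ j - polygonAngle n θ i) < 0 := by
  have hn : (0 : ℝ) < n := by exact_mod_cast (by omega : 0 < n)
  have h2 : (n : ℝ) < 2 * ((j : ℝ) - i) := by
    rw [← Nat.cast_sub (by omega)]; exact_mod_cast hn2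
  have h4 : (j : ℝ) < n := by exact_mod_cast hj
  have h3 : (0 : ℝ) ≤ i := Nat.cast_nonneg _
  rw [polygonAngle_sub, ← Real.sin_sub_two_pi]
  apply Real.sin_neg_of_neg_of_neg_pi_lt
  · rw [sub_neg]
    refine mul_lt_mul_of_pos_left ?_ two_pos
    rw [div_lt_iff₀ hn]
    exact mul_lt_mul_of_pos_left (by linarith) Real.pi_pos
  · have : Real.pi < 2 * (Real.pi * ((j : ℝ) - i) / n) := by
      rw [← mul_div_assoc, lt_div_iff₀ hn]
      nlinarith [mul_lt_mul_of_pos_left h2 Real.pi_pos]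
    linarith

/-- The summand is the number of leaves cut off by a chord spanning `t` steps. At `t = 0` truncated
subtraction gives 0, which matches the degenerate chord. -/
theorem sum_min_sub_one_odd (m : ℕ) :
    ∑ t ∈ Finset.range (2 * m + 1), (min t (2 * m + 1 - t) - 1) = m * (m - 1) := by
  rw [show 2 * m + 1 = (m + 1) + m by ring, Finset.sum_range_add, Finset.sum_range_succ',
    ← Finset.sum_range_id_mul_two, mul_two]
  congr 1
  · rw [add_eq_left.2 (by simp)]
    refine Finset.sum_congr rfl fun t ht => ?_
    have := Finset.mem_range.1 ht
    omega
  · rw [← Finset.sum_range_reflect]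
    refine Finset.sum_congr rfl fun t ht => ?_
    have := Finset.mem_range.1 ht
    omega

theorem sum_min_sub_one_even (k : ℕ) :
    ∑ t ∈ Finset.range (2 * (k + 1)), (min t (2 * (k + 1) - t) - 1) = k * k := by
  rw [show 2 * (k + 1) = (k + 1) + (k + 1) by ring, Finset.sum_range_add,
    Finset.sum_range_succ']
  have h1 : ∑ t ∈ Finset.range k, (min (t + 1) (k + 1 + (k + 1) - (t + 1)) - 1) =
      ∑ t ∈ Finset.range k, t := by
    refine Finset.sum_congr rfl fun t ht => ?_
    have := Finset.mem_range.1 ht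
    omega
  have h2 : ∑ t ∈ Finset.range (k + 1), (min (k + 1 + t) (k + 1 + (k + 1) - (k + 1 + t)) - 1) =
      ∑ t ∈ Finset.range (k + 1), t := by
    rw [← Finset.sum_range_reflect (fun t => t)]
    refine Finset.sum_congr rfl fun t ht => ?_
    have := Finset.mem_range.1 ht
    omega
  rw [h1, h2, Finset.sum_range_succ]
  have h3 := Finset.sum_range_id_mul_two k
  rcases k with _ | k
  · simp
  · simp only [Nat.add_sub_cancel] at h3
    simp
    nlinarith

theorem four_mul_sum_min_sub_one {n : ℕ} (hn : 0 < n) :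
    4 * (n : ℤ) * ((∑ t ∈ Finset.range n, (min t (n - t) - 1) : ℕ) : ℤ) = starBound n := by
  unfold starBound
  split_ifs with h
  · obtain ⟨m, rfl⟩ := h
    obtain ⟨k, rfl⟩ := Nat.exists_eq_succ_of_ne_zero (by omega : m ≠ 0)
    rw [← two_mul, sum_min_sub_one_even]
    push_cast
    ring
  · obtain ⟨m, rfl⟩ := Nat.not_even_iff_odd.1 h
    rw [sum_min_sub_one_odd]
    rcases m with _ | m
    · simp
    · push_cast
      ring

theorem Fin.val_sub_eq_ite {n : ℕ} (a b : Fin n) :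
    ((b - a : Fin n) : ℕ) = if a ≤ b then (b : ℕ) - a else n - (a - b) := by
  split_ifs with h
  · exact Fin.sub_val_of_le h
  · rw [Fin.coe_sub_iff_lt.2 (not_le.1 h)]
    have := a.isLt
    have := Fin.lt_def.1 (not_le.1 h)
    omega

/-! ### Balanced drawings attain the bound -/

namespace RectilinearDrawing

variable {n : ℕ} (R : RectilinearDrawing (Fin n ⊕ Fin 1))

/-- The leaves are in convex position, in counterclockwise order, and the hub lies on the side of
each non-diametral chord that contains the larger number of leaves. -/
structure IsBalanced : Prop where
  convex : ∀ i j k : Fin n, i < j → j < k →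
    0 < orient (R.pos (Sum.inl i)) (R.pos (Sum.inl j)) (R.pos (Sum.inl k))
  pos_of_short : ∀ i j : Fin n, i < j → 2 * ((j : ℕ) - i) < n → 0 < R.hubOrient i j
  neg_of_long : ∀ i j : Fin n, n < 2 * ((j : ℕ) - i) → R.hubOrient i j < 0

namespace IsBalanced

variable {R}

theorem orient_neg_of_between (hR : R.IsBalanced) {i j k : Fin n} (hij : i < j) (hjk : j < k) :
    orient (R.pos (Sum.inl i)) (R.pos (Sum.inl k)) (R.pos (Sum.inl j)) < 0 := by
  rw [orient_swap]
  exact neg_neg_iff_pos.2 (hR.convex i j k hij hjk)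

theorem orient_pos_of_outside (hR : R.IsBalanced) {i j k : Fin n} (hij : i < j) (hk : k < i ∨ j < k) :
    0 < orient (R.pos (Sum.inl i)) (R.pos (Sum.inl j)) (R.pos (Sum.inl k)) := by
  rcases hk with hk | hk
  · rw [← orient_rotate]
    exact hR.convex k i j hk hij
  · exact hR.convex i j k hij hk

end IsBalanced

end RectilinearDrawing

namespace RectilinearDrawing

variable {n : ℕ} {R : RectilinearDrawing (Fin n ⊕ Fin 1)}

namespace IsBalanced

/-- The chord leaves `b - a - 1` leaves on one side and `n - (b - a) - 1` on the other, and cuts the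
hub off from the smaller group. For a diametral chord the groups are equal, so the side of the hub
is irrelevant. -/
theorem card_separated (hR : R.IsBalanced) {a b : Fin n} (hab : a < b) :
    (∑ i : Fin n, if R.hubOrient a b *
      orient (R.pos (Sum.inl a)) (R.pos (Sum.inl b)) (R.pos (Sum.inl i)) < 0 then 1 else 0) =
      min ((b : ℕ) - a) (n - (b - a)) - 1 := by
  have ha := a.isLt
  have hb := b.isLt
  have hab' := Fin.lt_def.1 hab
  have hi : ∀ i : Fin n, i = a ∨ i = b ∨ (a < i ∧ i < b) ∨ (i < a ∨ b < i) := by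
    intro i
    simp only [Fin.ext_iff, Fin.lt_def]
    omega
  rw [← Finset.card_filter]
  rcases lt_or_gt_of_ne (R.hubOrient_ne_zero hab.ne) with h | h
  · have h1 : ¬ 2 * ((b : ℕ) - a) < n := fun h2 => (hR.pos_of_short a b hab h2).not_gt h
    have : Finset.univ.filter (fun i : Fin n => R.hubOrient a b *
        orient (R.pos (Sum.inl a)) (R.pos (Sum.inl b)) (R.pos (Sum.inl i)) < 0) =
        (Finset.Icc a b)ᶜ := by
      ext i
      simp only [Finset.mem_filter, Finset.mem_univ, true_and, Finset.mem_compl, Finset.mem_Icc]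
      rcases hi i with rfl | rfl | ⟨h2, h3⟩ | h2
      · simp [hab.le]
      · simp [hab.le]
      · simp only [h2.le, h3.le, and_self, not_true, iff_false, not_lt]
        exact (mul_pos_of_neg_of_neg h (hR.orient_neg_of_between h2 h3)).le
      · refine iff_of_true (mul_neg_of_neg_of_pos h (hR.orient_pos_of_outside hab h2)) ?_
        rintro ⟨h3, h4⟩
        rcases h2 with h2 | h2
        · exact absurd h2 (not_lt.2 h3)
        · exact absurd h2 (not_lt.2 h4)
    rw [this, Finset.card_compl, Fin.card_Icc, Fintype.card_fin]
    omega
  · have h1 : ¬ n < 2 * ((b : ℕ) - a) := fun h2 => (hR.neg_of_long a b h2).not_gt h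
    have : Finset.univ.filter (fun i : Fin n => R.hubOrient a b *
        orient (R.pos (Sum.inl a)) (R.pos (Sum.inl b)) (R.pos (Sum.inl i)) < 0) =
        Finset.Ioo a b := by
      ext i
      simp only [Finset.mem_filter, Finset.mem_univ, true_and, Finset.mem_Ioo]
      rcases hi i with rfl | rfl | ⟨h2, h3⟩ | h2
      · simp
      · simp
      · exact iff_of_true (mul_neg_of_pos_of_neg h (hR.orient_neg_of_between h2 h3)) ⟨h2, h3⟩
      · refine iff_of_false (mul_pos h (hR.orient_pos_of_outside hab h2)).not_gt ?_
        rintro ⟨h3, h4⟩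
        rcases h2 with h2 | h2
        · exact absurd h2 h3.not_gt
        · exact absurd h2 h4.not_gt
    rw [this, Fin.card_Ioo]
    omega

theorem card_separated_eq (hR : R.IsBalanced) (a b : Fin n) :
    (∑ i : Fin n, if R.hubOrient a b *
      (R.hubOrient a b + R.hubOrient b i + R.hubOrient i a) < 0 then 1 else 0) =
      min ((b - a : Fin n) : ℕ) (n - (b - a : Fin n)) - 1 := by
  simp only [← orient_leaves]
  rw [Fin.val_sub_eq_ite]
  rcases lt_trichotomy a b with h | rfl | h
  · rw [if_pos h.le, hR.card_separated h]
  · simp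
  · have h1 := hR.card_separated h
    simp only [R.hubOrient_swap a b, orient_swap_left (R.pos (Sum.inl a)), neg_mul_neg] at h1
    rw [if_neg (not_le.2 h), h1]
    have := a.isLt
    have := Fin.lt_def.1 h
    omega

theorem eight_mul_spokeCrossings (hR : R.IsBalanced) [NeZero n] :
    8 * (R.spokeCrossings : ℤ) = starBound n := by
  have h := R.two_mul_spokeCrossings
  simp only [hR.card_separated_eq] at h
  have h1 : ∀ a : Fin n, ∑ b : Fin n, (min ((b - a : Fin n) : ℕ) (n - (b - a : Fin n)) - 1) =
      ∑ t ∈ Finset.range n, (min t (n - t) - 1) := by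
    intro a
    rw [← Fin.sum_univ_eq_sum_range (fun t => min t (n - t) - 1)]
    exact (Equiv.subRight a).sum_comp (fun t : Fin n => min (t : ℕ) (n - t) - 1)
  simp only [h1, Finset.sum_const, Finset.card_univ, Fintype.card_fin, smul_eq_mul] at h
  rw [← four_mul_sum_min_sub_one (Nat.pos_of_ne_zero (NeZero.ne n))]
  have h2 : (2 * (R.spokeCrossings : ℤ)) = n *
      ((∑ t ∈ Finset.range n, (min t (n - t) - 1) : ℕ) : ℤ) := by exact_mod_cast h
  linarith

theorem not_separated_succ (hR : R.IsBalanced) [NeZero n] {a b : Fin n} (hab : a < b)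
    (i : Fin n) :
    0 ≤ orient (R.pos (Sum.inl a)) (R.pos (Sum.inl b)) (R.pos (Sum.inl i)) *
      orient (R.pos (Sum.inl a)) (R.pos (Sum.inl b)) (R.pos (Sum.inl (i + 1))) := by
  have hout : ∀ j : Fin n, j ≤ a ∨ b ≤ j →
      0 ≤ orient (R.pos (Sum.inl a)) (R.pos (Sum.inl b)) (R.pos (Sum.inl j)) := by
    intro j hj
    by_cases h1 : j = a
    · simp [h1]
    by_cases h2 : j = b
    · simp [h2]
    exact (hR.orient_pos_of_outside hab (hj.imp (fun h => lt_of_le_of_ne h h1)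
      (fun h => lt_of_le_of_ne h (Ne.symm h2)))).le
  have hin : ∀ j : Fin n, a ≤ j → j ≤ b →
      orient (R.pos (Sum.inl a)) (R.pos (Sum.inl b)) (R.pos (Sum.inl j)) ≤ 0 := by
    intro j hj1 hj2
    by_cases h1 : j = a
    · simp [h1]
    by_cases h2 : j = b
    · simp [h2]
    exact (hR.orient_neg_of_between (lt_of_le_of_ne hj1 (Ne.symm h1))
      (lt_of_le_of_ne hj2 h2)).le
  have hv := Fin.val_add_one_eq_ite i
  have hb := b.isLt
  have hi := i.isLt
  simp only [Fin.le_def] at hout hin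
  rw [Fin.lt_def] at hab
  -- The half-open condition says that the rim edge from `i` lies in the closed arc from `a` to `b`;
  -- otherwise both its ends lie in the complementary closed arc.
  by_cases hc : a ≤ (i : ℕ) ∧ (i : ℕ) < b
  · refine mul_nonneg_of_nonpos_of_nonpos (hin _ (by omega) (by omega)) (hin _ ?_ ?_) <;>
    · split_ifs at hv <;> omega
  · refine mul_nonneg (hout _ (by omega)) (hout _ ?_)
    split_ifs at hv <;> omega

theorem hubOrient_pos (hR : R.IsBalanced) {k j : Fin n} (h0 : 0 < ((j - k : Fin n) : ℕ))
    (h : 2 * ((j - k : Fin n) : ℕ) < n) : 0 < R.hubOrient k j := by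
  rw [Fin.val_sub_eq_ite] at h0 h
  have hk := k.isLt
  split_ifs at h0 h with hkj
  · exact hR.pos_of_short k j (Fin.lt_def.2 (by omega)) h
  · rw [hubOrient_swap]
    exact neg_pos.2 (hR.neg_of_long j k (by omega))

theorem hubOrient_neg (hR : R.IsBalanced) {k j : Fin n}
    (h : n < 2 * ((j - k : Fin n) : ℕ)) : R.hubOrient k j < 0 := by
  rw [Fin.val_sub_eq_ite] at h
  have hk := k.isLt
  split_ifs at h with hkj
  · exact hR.neg_of_long k j h
  · rw [hubOrient_swap]
    exact neg_neg_iff_pos.2 (hR.pos_of_short j k (not_le.1 hkj) (by omega))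

/-- Leaves less than half a turn after `k` are on the positive side and those more than half a turn
after it on the negative side, so the line can only cross the rim near the antipode of `k`. -/
theorem separated_by_spoke (hR : R.IsBalanced) [NeZero n] {k i : Fin n}
    (h : R.hubOrient k i * R.hubOrient k (i + 1) < 0) :
    ((i + 1 - k : Fin n) : ℕ) = (i - k : Fin n) + 1 ∧
      2 * ((i - k : Fin n) : ℕ) ≤ n ∧ n ≤ 2 * ((i - k : Fin n) : ℕ) + 2 := by
  have hv := Fin.val_add_one_eq_ite (i - k)
  rw [show i - k + 1 = i + 1 - k by abel] at hv
  have hne : ∀ j, R.hubOrient k j ≠ 0 → ((j - k : Fin n) : ℕ) ≠ 0 := by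
    intro j hj h0
    have h1 : j - k = 0 := Fin.ext h0
    rw [sub_eq_zero.1 h1] at hj
    simp at hj
  have h1 := hne i (by rintro h0; simp [h0] at h)
  have h2 := hne (i + 1) (by rintro h0; simp [h0] at h)
  have hlt := (i - k).isLt
  have hv' : ((i + 1 - k : Fin n) : ℕ) = (i - k : Fin n) + 1 := by
    split_ifs at hv <;> omega
  refine ⟨hv', ?_, ?_⟩
  · by_contra hc
    exact h.not_gt (mul_pos_of_neg_of_neg (hR.hubOrient_neg (by omega))
      (hR.hubOrient_neg (by omega)))
  · by_contra hc
    exact h.not_gt (mul_pos (hR.hubOrient_pos (by omega) (by omega))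
      (hR.hubOrient_pos (by omega) (by omega)))

/-- Two crossed edges would have to be the two meeting at the antipode of `k`, with `n` even. The
signs just before and just after the antipode differ, so only one of these edges is crossed. -/
theorem not_separated_twice (hR : R.IsBalanced) [NeZero n] {k i j : Fin n}
    (hi : R.hubOrient k i * R.hubOrient k (i + 1) < 0)
    (hj : R.hubOrient k j * R.hubOrient k (j + 1) < 0) :
    ¬ ((i - k : Fin n) : ℕ) < (j - k : Fin n) := by
  intro hlt
  obtain ⟨a1, a2, a3⟩ := hR.separated_by_spoke hi
  obtain ⟨b1, b2, b3⟩ := hR.separated_by_spoke hj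
  have hij : i + 1 - k = j - k := Fin.ext (by omega)
  rw [sub_left_inj.1 hij] at hi
  have hneg := hR.hubOrient_neg (k := k) (j := j + 1) (by omega)
  have hpos : 0 < R.hubOrient k i := by
    apply hR.hubOrient_pos _ (by omega)
    rw [Nat.pos_iff_ne_zero]
    intro h0
    have h1 : i - k = 0 := Fin.ext h0
    rw [sub_eq_zero.1 h1] at hi
    simp at hi
  have h1 : R.hubOrient k j < 0 := not_le.1 fun hc => (mul_nonneg hpos.le hc).not_gt hi
  exact hj.not_gt (mul_pos_of_neg_of_neg h1 hneg)

theorem rimCrossings_le (hR : R.IsBalanced) [NeZero n] : R.rimCrossings ≤ n := by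
  refine Nat.le_of_mul_le_mul_left (c := 2) ?_ (by norm_num)
  rw [rimCrossings, Finset.mul_sum]
  simp only [two_mul_separationNumber_leaves]
  rw [Finset.sum_add_distrib, ← Finset.mul_sum, Finset.sum_comm (f := fun i k =>
    if R.hubOrient k i * R.hubOrient k (i + 1) < 0 then 1 else 0)]
  rw [Finset.sum_eq_zero, zero_add]
  · refine Nat.mul_le_mul_left _ ?_
    have : ∀ k ∈ Finset.univ,
        (∑ i : Fin n, if R.hubOrient k i * R.hubOrient k (i + 1) < 0 then 1 else 0) ≤ 1 := by
      intro k _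
      rw [← Finset.card_filter, Finset.card_le_one]
      intro i hi j hj
      simp only [Finset.mem_filter, Finset.mem_univ, true_and] at hi hj
      have h1 := hR.not_separated_twice hi hj
      have h2 := hR.not_separated_twice hj hi
      exact sub_left_inj.1 (Fin.ext (le_antisymm (not_lt.1 h2) (not_lt.1 h1)))
    simpa using Finset.sum_le_sum this
  · intro i _
    refine Finset.sum_eq_zero fun a _ => Finset.sum_eq_zero fun b _ => if_neg (not_lt.2 ?_)
    rcases lt_trichotomy a b with h | rfl | h
    · exact hR.not_separated_succ h i
    · simp
    · rw [orient_swap_left (R.pos (Sum.inl b)), orient_swap_left (R.pos (Sum.inl b)),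
        neg_mul_neg]
      exact hR.not_separated_succ h i

theorem eight_mul_crossingNumber (hR : R.IsBalanced) (hn : 5 ≤ n) :
    8 * (R.crossingNumber (wheelGraph n) : ℤ) = starBound n + 8 * n := by
  have : NeZero n := ⟨by omega⟩
  refine le_antisymm ?_ (R.starBound_add_le hn)
  rw [R.crossingNumber_wheelGraph (by omega)]
  have h1 := hR.eight_mul_spokeCrossings
  have h2 : (R.rimCrossings : ℤ) ≤ n := by exact_mod_cast hR.rimCrossings_le
  push_cast
  linarith

end IsBalanced

end RectilinearDrawing

/-! ### Regular drawings are balanced and exist -/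

theorem IsCenteredRegularDrawing.isBalanced {n : ℕ} {R : RectilinearDrawing (Fin n ⊕ Fin 1)}
    (hR : IsCenteredRegularDrawing R) : R.IsBalanced := by
  obtain ⟨c, ⟨r, θ, hr, hp⟩, hodd, heven⟩ := hR
  have hpos : ∀ i : Fin n, R.pos (Sum.inl i) = polarPoint c r (polygonAngle n θ i) := hp
  -- Only a weak inequality is available, because diametral chords pass through the center.
  have hmul : ∀ i j : Fin n, i ≠ j → 0 ≤ R.hubOrient i j *
      orient c (R.pos (Sum.inl i)) (R.pos (Sum.inl j)) := by
    intro i j hij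
    rcases Nat.even_or_odd n with hn | hn
    · have hne : R.pos (Sum.inl i) ≠ R.pos (Sum.inl j) := R.injective_pos.ne (by simpa using hij)
      have h := heven hn _ ⟨_, ⟨Sum.inl i, rfl⟩, _, ⟨Sum.inl j, rfl⟩, hne, rfl⟩
      rw [sOppSide_line_iff hne, not_lt, ← orient_rotate (R.pos (Sum.inr 0)),
        ← orient_rotate c] at h
      exact h
    · rw [← hodd hn]
      exact mul_self_nonneg _
  refine ⟨?_, ?_, ?_⟩
  · intro i j k hij hjk
    rw [hpos, hpos, hpos, orient_polarPoint]
    have h1 := sin_half_polygonAngle_pos θ (Fin.lt_def.1 hij) j.isLt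
    have h2 := sin_half_polygonAngle_pos θ (Fin.lt_def.1 hjk) k.isLt
    have h3 := sin_half_polygonAngle_pos θ (Fin.lt_def.1 (hij.trans hjk)) k.isLt
    positivity
  · intro i j hij h
    have h1 := hmul i j hij.ne
    rw [hpos, hpos, orient_polarPoint_center] at h1
    have h2 := sin_polygonAngle_pos θ (Fin.lt_def.1 hij) h
    refine lt_of_le_of_ne ?_ (R.hubOrient_ne_zero hij.ne).symm
    exact nonneg_of_mul_nonneg_left h1 (mul_pos (mul_pos hr hr) h2)
  · intro i j h
    have hij : i ≠ j := by rintro rfl; omega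
    have h1 := hmul i j hij
    rw [hpos, hpos, orient_polarPoint_center] at h1
    have h2 := sin_polygonAngle_neg θ j.isLt h
    refine lt_of_le_of_ne ?_ (R.hubOrient_ne_zero hij)
    by_contra h3
    have h4 := mul_pos (mul_pos (mul_pos hr hr) (neg_pos.2 h2)) (not_le.1 h3)
    linarith

theorem exists_drawing_polygon_hub {n : ℕ} (hn : 3 ≤ n) (h : Plane)
    (hh : ∀ i j : Fin n, i ≠ j → orient h (polarPoint 0 1 (polygonAngle n 0 i))
      (polarPoint 0 1 (polygonAngle n 0 j)) ≠ 0) :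
    ∃ R : RectilinearDrawing (Fin n ⊕ Fin 1), R.pos (Sum.inr 0) = h ∧
      ∀ i, R.pos (Sum.inl i) = polarPoint 0 1 (polygonAngle n 0 i) := by
  refine ⟨RectilinearDrawing.ofOrient
    (Sum.elim (fun i : Fin n => polarPoint 0 1 (polygonAngle n 0 i)) (fun _ => h)) ?_ ?_,
    rfl, fun _ => rfl⟩
  · intro a b
    classical
    obtain ⟨c, -, hc⟩ := Finset.exists_mem_notMem_of_card_lt_card
      (s := ({a, b} : Finset (Fin n ⊕ Fin 1))) (t := Finset.univ)
      (lt_of_le_of_lt Finset.card_le_two (by simp; omega))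
    simp only [Finset.mem_insert, Finset.mem_singleton, not_or] at hc
    exact ⟨c, Ne.symm hc.1, Ne.symm hc.2⟩
  · rintro (a | a) (b | b) (c | c) hab hac hbc
    · simp only [ne_eq, Sum.inl.injEq] at hab hac hbc
      have key : ∀ i j : Fin n, i ≠ j → Real.sin
          ((polygonAngle n 0 j - polygonAngle n 0 i) / 2) ≠ 0 := fun i j hij =>
        sin_half_polygonAngle_ne_zero 0 (fun h => hij (Fin.ext h)) i.isLt j.isLt
      simp only [Sum.elim_inl, orient_polarPoint]
      have h1 := key a b hab
      have h2 := key b c hbc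
      have h3 := key a c hac
      positivity
    · simp only [Sum.elim_inl, Sum.elim_inr]
      rw [← orient_rotate]
      exact hh a b (by simpa using hab)
    · simp only [Sum.elim_inl, Sum.elim_inr]
      rw [orient_rotate]
      exact hh c a (by simpa using hac.symm)
    · exact absurd (congrArg Sum.inr (Subsingleton.elim b c)) hbc
    · simp only [Sum.elim_inl, Sum.elim_inr]
      exact hh b c (by simpa using hbc)
    · exact absurd (congrArg Sum.inr (Subsingleton.elim a c)) hac
    · exact absurd (congrArg Sum.inr (Subsingleton.elim a b)) hab
    · exact absurd (congrArg Sum.inr (Subsingleton.elim a b)) hab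

theorem exists_int_of_sin_polygonAngle_eq_zero {n : ℕ} (hn : 0 < n) (θ : ℝ) {i j : ℕ}
    (h : Real.sin (polygonAngle n θ j - polygonAngle n θ i) = 0) :
    ∃ k : ℤ, k * n = 2 * ((j : ℤ) - i) := by
  obtain ⟨k, hk⟩ := Real.sin_eq_zero_iff.1 h
  refine ⟨k, ?_⟩
  have hn' : (n : ℝ) ≠ 0 := by positivity
  rw [polygonAngle_sub] at hk
  field_simp at hk
  exact_mod_cast hk

theorem exists_centered_drawing_of_odd {n : ℕ} (hn : 3 ≤ n) (ho : Odd n) :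
    ∃ R : RectilinearDrawing (Fin n ⊕ Fin 1), IsCenteredRegularDrawing R := by
  obtain ⟨R, h1, h2⟩ := exists_drawing_polygon_hub hn 0 (by
    intro i j hij
    rw [orient_polarPoint_center, one_mul, one_mul]
    intro h0
    obtain ⟨k, hk⟩ := exists_int_of_sin_polygonAngle_eq_zero (by omega) _ h0
    have h3 : (n : ℤ) ∣ 2 * ((j : ℤ) - i) := ⟨k, by rw [← hk]; ring⟩
    have h4 : IsCoprime (n : ℤ) 2 := by
      exact_mod_cast Nat.isCoprime_iff_coprime.2 (Nat.coprime_two_left.2 ho).symm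
    have h5 := h4.dvd_of_dvd_mul_left h3
    have hi := i.isLt
    have hj := j.isLt
    have h6 := Int.eq_zero_of_abs_lt_dvd h5 (abs_lt.2 ⟨by omega, by omega⟩)
    exact hij (Fin.ext (by omega)))
  exact ⟨R, 0, ⟨1, 0, one_pos, h2⟩, fun _ => h1, fun he => absurd ho (Nat.not_odd_iff_even.2 he)⟩

theorem orient_polarPoint_hub (s x y z : ℝ) :
    orient (polarPoint 0 s x) (polarPoint 0 1 y) (polarPoint 0 1 z) =
      Real.sin (z - y) + s * (Real.sin (y - x) - Real.sin (z - x)) := by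
  rw [orient_eq_add 0]
  simp only [orient_polarPoint_center]
  rw [← neg_sub z x, Real.sin_neg]
  ring

/-- The direction `π / n` is half a step from a vertex direction. For even `n` the diameters point
along vertex directions only, so moving the hub this way takes it off all of them. -/
theorem orient_hub_ne_zero_of_diametral {n : ℕ} (hn : 0 < n) (he : Even n) {i j : ℕ}
    (hij : i ≠ j) (hi : i < n) (hj : j < n)
    (h0 : Real.sin (polygonAngle n 0 j - polygonAngle n 0 i) = 0) {s : ℝ} (hs : s ≠ 0) :
    orient (polarPoint 0 s (Real.pi / n)) (polarPoint 0 1 (polygonAngle n 0 i))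
      (polarPoint 0 1 (polygonAngle n 0 j)) ≠ 0 := by
  have hn' : (n : ℝ) ≠ 0 := by positivity
  rw [orient_polarPoint_hub, h0, zero_add]
  have h1 : Real.sin (polygonAngle n 0 i - Real.pi / n) ≠ 0 := by
    intro h
    obtain ⟨k, hk⟩ := Real.sin_eq_zero_iff.1 h
    unfold polygonAngle at hk
    field_simp at hk
    have hk' : k * (n : ℤ) = 2 * i - 1 := by
      have : (k : ℝ) * n = 2 * i - 1 :=
        mul_left_cancel₀ Real.pi_ne_zero (by linarith)
      exact_mod_cast this
    obtain ⟨m, rfl⟩ := he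
    have : (2 : ℤ) * (k * m) = 2 * i - 1 := by rw [← hk']; push_cast; ring
    omega
  have h2 : Real.sin (polygonAngle n 0 j - Real.pi / n) =
      -Real.sin (polygonAngle n 0 i - Real.pi / n) := by
    obtain ⟨k, hk⟩ := exists_int_of_sin_polygonAngle_eq_zero hn _ h0
    have hk0 : k ≠ 0 := by rintro rfl; omega
    have hk1 : k < 2 := by
      by_contra hc
      nlinarith [mul_le_mul_of_nonneg_right (not_lt.1 hc) (Int.natCast_nonneg n)]
    have hk2 : -2 < k := by
      by_contra hc
      nlinarith [mul_le_mul_of_nonneg_right (not_lt.1 hc) (Int.natCast_nonneg n)]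
    have hkr : (k : ℝ) * n = 2 * ((j : ℝ) - i) := by exact_mod_cast hk
    have hd : polygonAngle n 0 j - Real.pi / n =
        polygonAngle n 0 i - Real.pi / n + k * Real.pi := by
      unfold polygonAngle
      field_simp
      linear_combination -Real.pi * hkr
    rw [hd]
    obtain rfl | rfl : k = 1 ∨ k = -1 := by omega
    · rw [Int.cast_one, one_mul, Real.sin_add_pi]
    · rw [Int.cast_neg, Int.cast_one, neg_one_mul, ← sub_eq_add_neg, Real.sin_sub_pi]
  rw [h2, sub_neg_eq_add, ← two_mul]
  exact mul_ne_zero hs (mul_ne_zero two_ne_zero h1)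

open Filter Topology in
theorem exists_hub_near_center {n : ℕ} (hn : 0 < n) (he : Even n) :
    ∃ h : Plane, ∀ i j : Fin n, i ≠ j →
      orient h (polarPoint 0 1 (polygonAngle n 0 i)) (polarPoint 0 1 (polygonAngle n 0 j)) ≠ 0 ∧
      0 ≤ orient h (polarPoint 0 1 (polygonAngle n 0 i)) (polarPoint 0 1 (polygonAngle n 0 j)) *
        orient 0 (polarPoint 0 1 (polygonAngle n 0 i)) (polarPoint 0 1 (polygonAngle n 0 j)) := by
  have hev : ∀ᶠ s in 𝓝[>] (0 : ℝ), ∀ i j : Fin n, i ≠ j →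
      orient (polarPoint 0 s (Real.pi / n)) (polarPoint 0 1 (polygonAngle n 0 i))
        (polarPoint 0 1 (polygonAngle n 0 j)) ≠ 0 ∧
      0 ≤ orient (polarPoint 0 s (Real.pi / n)) (polarPoint 0 1 (polygonAngle n 0 i))
        (polarPoint 0 1 (polygonAngle n 0 j)) *
        orient 0 (polarPoint 0 1 (polygonAngle n 0 i)) (polarPoint 0 1 (polygonAngle n 0 j)) := by
    refine eventually_all.2 fun i => eventually_all.2 fun j => ?_
    by_cases hij : i = j
    · exact Eventually.of_forall fun _ h => absurd hij h
    simp only [orient_polarPoint_center, one_mul]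
    by_cases h0 : Real.sin (polygonAngle n 0 j - polygonAngle n 0 i) = 0
    · filter_upwards [self_mem_nhdsWithin] with s hs _
      refine ⟨orient_hub_ne_zero_of_diametral hn he (fun h => hij (Fin.ext h)) i.isLt j.isLt h0
        (ne_of_gt hs), ?_⟩
      rw [h0, mul_zero]
    -- A chord missing the center keeps the hub strictly on the center's side for small `s`, by
    -- continuity at `s = 0`.
    · have hc : Continuous fun s : ℝ =>
          orient (polarPoint 0 s (Real.pi / n)) (polarPoint 0 1 (polygonAngle n 0 i))
          (polarPoint 0 1 (polygonAngle n 0 j)) *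
            Real.sin (polygonAngle n 0 j - polygonAngle n 0 i) := by
        simp only [orient_polarPoint_hub]
        fun_prop
      have hlim := (hc.tendsto 0).mono_left (nhdsWithin_le_nhds (s := Set.Ioi 0))
      have hpos : 0 < orient (polarPoint 0 0 (Real.pi / n)) (polarPoint 0 1 (polygonAngle n 0 i))
          (polarPoint 0 1 (polygonAngle n 0 j)) *
            Real.sin (polygonAngle n 0 j - polygonAngle n 0 i) := by
        rw [orient_polarPoint_hub, zero_mul, add_zero]
        exact mul_self_pos.2 h0
      filter_upwards [hlim.eventually_const_lt hpos] with s hs _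
      exact ⟨left_ne_zero_of_mul hs.ne', hs.le⟩
  obtain ⟨s, hs⟩ := hev.exists
  exact ⟨_, hs⟩

theorem exists_centered_drawing_of_even {n : ℕ} (hn : 3 ≤ n) (he : Even n) :
    ∃ R : RectilinearDrawing (Fin n ⊕ Fin 1), IsCenteredRegularDrawing R := by
  obtain ⟨h, hh⟩ := exists_hub_near_center (by omega) he
  obtain ⟨R, h1, h2⟩ := exists_drawing_polygon_hub hn h fun i j hij => (hh i j hij).1
  refine ⟨R, 0, ⟨1, 0, one_pos, h2⟩, fun ho => absurd he (Nat.not_even_iff_odd.2 ho), ?_⟩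
  rintro _ L ⟨_, ⟨a, rfl⟩, _, ⟨b, rfl⟩, hab, rfl⟩
  rw [sOppSide_line_iff hab, not_lt]
  rcases a with a | a
  · rcases b with b | b
    · rw [h1, h2, h2, ← orient_rotate h, ← orient_rotate 0]
      exact (hh a b (by rintro rfl; exact hab rfl)).2
    · simp [Subsingleton.elim b 0]
  · simp [Subsingleton.elim a 0]

theorem exists_centered_drawing {n : ℕ} (hn : 3 ≤ n) :
    ∃ R : RectilinearDrawing (Fin n ⊕ Fin 1), IsCenteredRegularDrawing R :=
  (Nat.even_or_odd n).elim (exists_centered_drawing_of_even hn) (exists_centered_drawing_of_odd hn)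

/-! ### Orchard crossing numbers of the star and the wheel -/

theorem RectilinearDrawing.orchardCrossingNumber_le {V : Type*} [Fintype V]
    (R : RectilinearDrawing V) (G : SimpleGraph V) :
    orchardCrossingNumber G ≤ R.crossingNumber G :=
  Nat.sInf_le ⟨R, rfl⟩

theorem RectilinearDrawing.crossingNumber_eq_orchardCrossingNumber {V : Type*} [Fintype V]
    (R : RectilinearDrawing V) (G : SimpleGraph V)
    (h : ∀ R' : RectilinearDrawing V, R.crossingNumber G ≤ R'.crossingNumber G) :
    R.crossingNumber G = orchardCrossingNumber G := by
  refine le_antisymm (le_csInf ⟨_, R, rfl⟩ ?_) (R.orchardCrossingNumber_le G)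
  rintro _ ⟨R', rfl⟩
  exact h R'

/-- This direction is all that the comparison of wheel drawings with the star needs, since
`starBound_add_le` is already stated through `starBound`. -/
theorem eight_mul_orchardCrossingNumber_starGraph_le {n : ℕ} (hn : 3 ≤ n) :
    8 * (orchardCrossingNumber (starGraph n) : ℤ) ≤ starBound n := by
  obtain ⟨R, hR⟩ := exists_centered_drawing hn
  have : NeZero n := ⟨by omega⟩
  rw [← hR.isBalanced.eight_mul_spokeCrossings, ← R.crossingNumber_starGraph]
  have : (orchardCrossingNumber (starGraph n) : ℤ) ≤ R.crossingNumber (starGraph n) := by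
    exact_mod_cast R.orchardCrossingNumber_le _
  linarith

theorem IsCenteredRegularDrawing.crossingNumber_eq {n : ℕ} (hn : 5 ≤ n)
    {R : RectilinearDrawing (Fin n ⊕ Fin 1)} (hR : IsCenteredRegularDrawing R) :
    R.crossingNumber (wheelGraph n) = orchardCrossingNumber (wheelGraph n) := by
  refine R.crossingNumber_eq_orchardCrossingNumber _ fun R' => ?_
  have h1 := hR.isBalanced.eight_mul_crossingNumber hn
  have h2 := R'.starBound_add_le hn
  omega

theorem eight_mul_orchardCrossingNumber_wheelGraph {n : ℕ} (hn : 5 ≤ n) :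
    8 * (orchardCrossingNumber (wheelGraph n) : ℤ) = starBound n + 8 * n := by
  obtain ⟨R, hR⟩ := exists_centered_drawing (n := n) (by omega)
  rw [← hR.crossingNumber_eq hn, hR.isBalanced.eight_mul_crossingNumber hn]

theorem mainTheorem4 (n : ℕ) (hn : 5 ≤ n) :
    -- the configuration of the proposition exists and attains the minimum
    ((∃ R : RectilinearDrawing (Fin n ⊕ Fin 1), IsCenteredRegularDrawing R) ∧
      ∀ R : RectilinearDrawing (Fin n ⊕ Fin 1), IsCenteredRegularDrawing R →
        R.crossingNumber (wheelGraph n) = orchardCrossingNumber (wheelGraph n)) ∧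
    -- the values of the Orchard crossing number of the wheel
    (Odd n → (orchardCrossingNumber (wheelGraph n) : ℚ) =
      (n : ℚ) * ((n : ℚ) ^ 2 - 4 * (n : ℚ) + 11) / 8) ∧
    (Even n → (orchardCrossingNumber (wheelGraph n) : ℚ) =
      (n : ℚ) * ((n : ℚ) ^ 2 - 4 * (n : ℚ) + 12) / 8) ∧
    -- the lower bound for every drawing
    (∀ R : RectilinearDrawing (Fin n ⊕ Fin 1),
      orchardCrossingNumber (starGraph n) + n ≤ R.crossingNumber (wheelGraph n)) := by
  have hval := eight_mul_orchardCrossingNumber_wheelGraph hn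
  refine ⟨⟨exists_centered_drawing (by omega), fun R hR => hR.crossingNumber_eq hn⟩, ?_, ?_, ?_⟩
  · intro ho
    rw [starBound, if_neg (Nat.not_even_iff_odd.2 ho)] at hval
    have h : 8 * (orchardCrossingNumber (wheelGraph n) : ℚ) =
      n * ((n : ℚ) - 1) * (n - 3) + 8 * n := by exact_mod_cast hval
    linarith
  · intro he
    rw [starBound, if_pos he] at hval
    have h : 8 * (orchardCrossingNumber (wheelGraph n) : ℚ) =
      n * ((n : ℚ) - 2) ^ 2 + 8 * n := by exact_mod_cast hval
    linarith
  · intro R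
    have h1 := R.starBound_add_le hn
    have h2 := eight_mul_orchardCrossingNumber_starGraph_le (n := n) (by omega)
    omega
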